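/- For a finite simple undirected graph $G$ with $n$ vertices, let $A(G)$ be its adjacency matrix, $D(G)$ the diagonal matrix of its vertex degrees, and $Q(G)=D(G)+A(G)$ its signless Laplacian matrix, whose eigenvalues, counted with multiplicity, are written $q_1(G)\ge q_2(G)\ge\cdots\ge q_n(G)$. Theorem. Let $n\ge 6$ be an integer and let $G$ be a simple graph (not necessarily connected) with $n$ vertices and $m$ edges. Then $$q_n(G)\ \ge\ \frac{2m}{n-2}-n+1 .$$ Moreover, this bound together with $0$ is at least as strong as the bound conjectured by Lima et al. for connected graphs, that is, $$\frac{2m}{n-1}-n+2\ \le\ \max\Bigl\{0,\ \frac{2m}{n-2}-n+1\Bigr\},$$ and the conjectured inequality holds: $$q_n(G)\ \ge\ \frac{2m}{n-1}-n+2 .$$ -/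

import Mathlib

namespace SimpleGraph

/-- The signless Laplacian matrix `Q(G) = D(G) + A(G)` of a simple graph, over `ℝ`. -/
def signlessLapMatrix {V : Type*} [Fintype V] [DecidableEq V]
    (G : SimpleGraph V) [DecidableRel G.Adj] : Matrix V V ℝ :=
  G.degMatrix ℝ + G.adjMatrix ℝ

theorem isHermitian_signlessLapMatrix {V : Type*} [Fintype V] [DecidableEq V]
    (G : SimpleGraph V) [DecidableRel G.Adj] : G.signlessLapMatrix.IsHermitian :=
  (G.isHermitian_degMatrix (R := ℝ)).add (G.isHermitian_adjMatrix (R := ℝ))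

/-- The eigenvalues of `Q(G)`, with multiplicity, in nonincreasing order. The index starts at `0`,
so that `G.signlessLapEigenvalue i` is `q_{i+1}(G)`. -/
noncomputable def signlessLapEigenvalue {V : Type*} [Fintype V] [DecidableEq V]
    (G : SimpleGraph V) [DecidableRel G.Adj] : Fin (Fintype.card V) → ℝ :=
  G.isHermitian_signlessLapMatrix.eigenvalues₀

end SimpleGraph

/-! On k vertices with m edges, the form inequality Q ≥ (2m/(k-2) - (k-1)) I + c_k D is proved by
induction on k, averaging over all vertex deletions (`signless_form_le`). Deleting v removes x_v²
and deg v together, and their product leaves an extra multiple of D. This forces c_{k+1} = c_k +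
2/((k-1)(k-2)), hence c_k = const - 2/(k-2). The constant 1/2 gives c_6 = 0, so the D term can be
dropped exactly when k ≥ 6.

The base k = 5 has c_5 = -1/6 and reads Q + D/6 ≥ (2m/3 - 4) I. If at least four edges are missing,
the right side is nonpositive. Otherwise, subtracting from K_5 turns it into an upper bound for the
complement, Q + D/6 ≤ (1 + 2m/3) I + J with J all-ones and m ≤ 3 now counting complement edges
(`sum_edgeForm_le`). Only seven nonempty graphs arise. -/

/-! ### Explicit forms for the seven graphs with one to three edges -/

section QuadraticForms

variable (a b c d e : ℝ)

/-- Here and in the next six lemmas, the hints are the squares left by eliminating e, d, c, b, a in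
turn (an LDLᵀ factorization of right side minus left side). -/
theorem edge_form_le :
    (a + b) ^ 2 + (a ^ 2 + b ^ 2) / 6 ≤
      5 / 3 * (a ^ 2 + b ^ 2 + c ^ 2 + d ^ 2 + e ^ 2) + (a + b + c + d + e) ^ 2 := by
  linarith [sq_nonneg (e + 3/8 * d + 3/8 * c + 3/8 * b + 3/8 * a),
    sq_nonneg (d + 3/11 * c + 3/11 * b + 3/11 * a), sq_nonneg (c + 3/14 * b + 3/14 * a),
    sq_nonneg (b - 3/4 * a), sq_nonneg a]

theorem path_two_form_le :
    (a + b) ^ 2 + (a ^ 2 + b ^ 2) / 6 + ((a + c) ^ 2 + (a ^ 2 + c ^ 2) / 6) ≤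
      7 / 3 * (a ^ 2 + b ^ 2 + c ^ 2 + d ^ 2 + e ^ 2) + (a + b + c + d + e) ^ 2 := by
  linarith [sq_nonneg (e + 3/10 * d + 3/10 * c + 3/10 * b + 3/10 * a),
    sq_nonneg (d + 3/13 * c + 3/13 * b + 3/13 * a), sq_nonneg (c + 6/19 * b - 36/133 * a),
    sq_nonneg (b - 36/175 * a), sq_nonneg a]

theorem two_edges_form_le :
    (a + b) ^ 2 + (a ^ 2 + b ^ 2) / 6 + ((c + d) ^ 2 + (c ^ 2 + d ^ 2) / 6) ≤
      7 / 3 * (a ^ 2 + b ^ 2 + c ^ 2 + d ^ 2 + e ^ 2) + (a + b + c + d + e) ^ 2 := by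
  linarith [sq_nonneg (e + 3/10 * d + 3/10 * c + 3/10 * b + 3/10 * a),
    sq_nonneg (d - 9/56 * c + 3/8 * b + 3/8 * a), sq_nonneg (c + 21/47 * b + 21/47 * a),
    sq_nonneg (b - 261/350 * a), sq_nonneg a]

theorem triangle_form_le :
    (a + b) ^ 2 + (a ^ 2 + b ^ 2) / 6 + ((a + c) ^ 2 + (a ^ 2 + c ^ 2) / 6) +
        ((b + c) ^ 2 + (b ^ 2 + c ^ 2) / 6) ≤
      3 * (a ^ 2 + b ^ 2 + c ^ 2 + d ^ 2 + e ^ 2) + (a + b + c + d + e) ^ 2 := by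
  linarith [sq_nonneg (e + 1/4 * d + 1/4 * c + 1/4 * b + 1/4 * a),
    sq_nonneg (d + 1/5 * c + 1/5 * b + 1/5 * a), sq_nonneg (c - 6/19 * b - 6/19 * a),
    sq_nonneg (b - 6/13 * a), sq_nonneg a]

theorem star_form_le :
    (a + b) ^ 2 + (a ^ 2 + b ^ 2) / 6 + ((a + c) ^ 2 + (a ^ 2 + c ^ 2) / 6) +
        ((a + d) ^ 2 + (a ^ 2 + d ^ 2) / 6) ≤
      3 * (a ^ 2 + b ^ 2 + c ^ 2 + d ^ 2 + e ^ 2) + (a + b + c + d + e) ^ 2 := by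
  linarith [sq_nonneg (e + 1/4 * d + 1/4 * c + 1/4 * b + 1/4 * a),
    sq_nonneg (d + 9/31 * c + 9/31 * b - 3/31 * a), sq_nonneg (c + 9/40 * b - 3/40 * a),
    sq_nonneg (b - 3/49 * a), sq_nonneg a]

theorem path_three_form_le :
    (a + b) ^ 2 + (a ^ 2 + b ^ 2) / 6 + ((a + c) ^ 2 + (a ^ 2 + c ^ 2) / 6) +
        ((b + d) ^ 2 + (b ^ 2 + d ^ 2) / 6) ≤
      3 * (a ^ 2 + b ^ 2 + c ^ 2 + d ^ 2 + e ^ 2) + (a + b + c + d + e) ^ 2 := by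
  linarith [sq_nonneg (e + 1/4 * d + 1/4 * c + 1/4 * b + 1/4 * a),
    sq_nonneg (d + 9/31 * c - 3/31 * b + 9/31 * a), sq_nonneg (c + 153/440 * b - 87/440 * a),
    sq_nonneg (b - 39/2921 * a), sq_nonneg a]

theorem path_two_add_edge_form_le :
    (a + b) ^ 2 + (a ^ 2 + b ^ 2) / 6 + ((a + c) ^ 2 + (a ^ 2 + c ^ 2) / 6) +
        ((d + e) ^ 2 + (d ^ 2 + e ^ 2) / 6) ≤
      3 * (a ^ 2 + b ^ 2 + c ^ 2 + d ^ 2 + e ^ 2) + (a + b + c + d + e) ^ 2 := by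
  linarith [sq_nonneg (e + 6/17 * c + 6/17 * b + 6/17 * a),
    sq_nonneg (d + 6/17 * c + 6/17 * b + 6/17 * a), sq_nonneg (c + 30/217 * b - 72/217 * a),
    sq_nonneg (b - 72/247 * a), sq_nonneg a]

end QuadraticForms

/-- The value on an edge `s(i, j)` of the quadratic form of `Q + D / 6`. -/
noncomputable def edgeForm {V : Type*} (x : V → ℝ) : Sym2 V → ℝ :=
  Sym2.lift ⟨fun i j => (x i + x j) ^ 2 + (x i ^ 2 + x j ^ 2) / 6, fun i j => by ring⟩

@[simp]
theorem edgeForm_mk {V : Type*} (x : V → ℝ) (i j : V) :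
    edgeForm x s(i, j) = (x i + x j) ^ 2 + (x i ^ 2 + x j ^ 2) / 6 := rfl

theorem Sym2.share_or_disjoint {V : Type*} {e f : Sym2 V} (he : ¬ e.IsDiag) (hf : ¬ f.IsDiag)
    (hef : e ≠ f) :
    (∃ a b c, a ≠ b ∧ a ≠ c ∧ b ≠ c ∧ e = s(a, b) ∧ f = s(a, c)) ∨
      ∃ a b c d, a ≠ b ∧ c ≠ d ∧ a ≠ c ∧ a ≠ d ∧ b ≠ c ∧ b ≠ d ∧ e = s(a, b) ∧ f = s(c, d) := by
  induction e with | _ a b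
  induction f with | _ c d
  rw [Sym2.mk_isDiag_iff] at he hf
  by_cases h1 : a = c
  · subst h1
    exact .inl ⟨a, b, d, he, hf, fun h => hef (by rw [h]), rfl, rfl⟩
  by_cases h2 : a = d
  · subst h2
    exact .inl ⟨a, b, c, he, Ne.symm hf, fun h => hef (by rw [h, Sym2.eq_swap]), rfl, Sym2.eq_swap⟩
  by_cases h3 : b = c
  · subst h3
    exact .inl ⟨b, a, d, Ne.symm he, hf, fun h => hef (by rw [h, Sym2.eq_swap]), Sym2.eq_swap, rfl⟩
  by_cases h4 : b = d
  · subst h4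
    exact .inl ⟨b, a, c, Ne.symm he, Ne.symm hf, fun h => hef (by rw [h]), Sym2.eq_swap,
      Sym2.eq_swap⟩
  exact .inr ⟨a, b, c, d, he, hf, h1, h2, h3, h4, rfl, rfl⟩

/-! ### At most three edges on five vertices -/

section FiveVertices

variable {V : Type*} [Fintype V] [DecidableEq V]

theorem exists_univ_eq_of_card_eq_five (hV : Fintype.card V = 5) {a b c : V} (hab : a ≠ b)
    (hac : a ≠ c) (hbc : b ≠ c) :
    ∃ d e, (∀ v, v = a ∨ v = b ∨ v = c ∨ v = d ∨ v = e) ∧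
      ∀ f : V → ℝ, ∑ v, f v = f a + f b + f c + f d + f e := by
  have h3 : ({a, b, c} : Finset V).card = 3 := Finset.card_eq_three.2 ⟨a, b, c, hab, hac, hbc, rfl⟩
  have h2 : ({a, b, c} : Finset V)ᶜ.card = 2 := by rw [Finset.card_compl, hV, h3]
  obtain ⟨d, e, hde, h⟩ := Finset.card_eq_two.1 h2
  refine ⟨d, e, fun v => ?_, fun f => ?_⟩
  · by_cases hv : v ∈ ({a, b, c} : Finset V)
    · simp only [Finset.mem_insert, Finset.mem_singleton] at hv
      tauto
    · rw [← Finset.mem_compl, h] at hv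
      simp only [Finset.mem_insert, Finset.mem_singleton] at hv
      tauto
  · rw [← Finset.sum_add_sum_compl {a, b, c}, h, Finset.sum_pair hde,
      Finset.sum_insert (by simp [hab, hac]), Finset.sum_pair hbc]
    ring

/-- A third edge added to the path b-a-c makes a star, a triangle, a three-edge path, or a path plus
a disjoint edge. -/
theorem edgeForm_three_le_of_share (hV : Fintype.card V = 5) (x : V → ℝ) {a b c : V}
    (hab : a ≠ b) (hac : a ≠ c) (hbc : b ≠ c) {g : Sym2 V} (hg : ¬ g.IsDiag) (hgb : s(a, b) ≠ g)
    (hgc : s(a, c) ≠ g) :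
    edgeForm x s(a, b) + edgeForm x s(a, c) + edgeForm x g ≤
      3 * ∑ v, x v ^ 2 + (∑ v, x v) ^ 2 := by
  obtain ⟨d, e, hmem, hsum⟩ := exists_univ_eq_of_card_eq_five hV hab hac hbc
  rw [hsum, hsum]
  induction g with | _ p q
  rw [Sym2.mk_isDiag_iff] at hg
  have key : ∀ p q, p ≠ q → s(a, b) ≠ s(p, q) → s(a, c) ≠ s(p, q) →
      (p = a ∨ p = b ∨ (p = c ∧ q ≠ a ∧ q ≠ b) ∨ (p = d ∧ q = e)) →
      edgeForm x s(a, b) + edgeForm x s(a, c) + edgeForm x s(p, q) ≤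
        3 * (x a ^ 2 + x b ^ 2 + x c ^ 2 + x d ^ 2 + x e ^ 2) +
          (x a + x b + x c + x d + x e) ^ 2 := by
    intro p q hpq hb hc hp
    simp only [edgeForm_mk]
    rcases hp with rfl | rfl | ⟨rfl, hqa, hqb⟩ | ⟨rfl, rfl⟩
    · rcases hmem q with rfl | rfl | rfl | rfl | rfl
      · exact absurd rfl hpq
      · exact absurd rfl hb
      · exact absurd rfl hc
      · exact star_form_le ..
      · linarith [star_form_le (x p) (x b) (x c) (x q) (x d)]
    · rcases hmem q with rfl | rfl | rfl | rfl | rfl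
      · exact absurd Sym2.eq_swap hb
      · exact absurd rfl hpq
      · exact triangle_form_le ..
      · exact path_three_form_le ..
      · linarith [path_three_form_le (x a) (x p) (x c) (x q) (x d)]
    · rcases hmem q with rfl | rfl | rfl | rfl | rfl
      · exact absurd rfl hqa
      · exact absurd rfl hqb
      · exact absurd rfl hpq
      · linarith [path_three_form_le (x a) (x p) (x b) (x q) (x e)]
      · linarith [path_three_form_le (x a) (x p) (x b) (x q) (x d)]
    · exact path_two_add_edge_form_le ..
  -- Every admissible edge falls under `key` in one of its two orientations.
  by_cases h : p = a ∨ p = b ∨ (p = c ∧ q ≠ a ∧ q ≠ b) ∨ (p = d ∧ q = e)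
  · exact key p q hg hgb hgc h
  · rw [Sym2.eq_swap (a := p)] at hgb hgc ⊢
    refine key q p (Ne.symm hg) hgb hgc ?_
    have hp := hmem p
    have hq := hmem q
    grind

/-- Among the graphs on five vertices with at most three edges, the largest value of the quadratic
form of `Q + D / 6` is controlled by the number of edges and the all-ones matrix. -/
theorem sum_edgeForm_le (hV : Fintype.card V = 5) (x : V → ℝ) (E : Finset (Sym2 V))
    (hE : ∀ e ∈ E, ¬ e.IsDiag) (hcard : E.card ≤ 3) :
    ∑ e ∈ E, edgeForm x e ≤ (1 + 2 / 3 * E.card) * ∑ v, x v ^ 2 + (∑ v, x v) ^ 2 := by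
  obtain h | h | h | h : E.card = 0 ∨ E.card = 1 ∨ E.card = 2 ∨ E.card = 3 := by omega
  · rw [Finset.card_eq_zero.1 h]
    simp only [Finset.sum_empty, Finset.card_empty]
    positivity
  · obtain ⟨e, rfl⟩ := Finset.card_eq_one.1 h
    have he := hE e (by simp)
    induction e with | _ a b
    rw [Sym2.mk_isDiag_iff] at he
    obtain ⟨c, hc⟩ : ∃ c, c ∉ ({a, b} : Finset V) := by
      by_contra! hall
      have := Finset.card_le_card (fun v _ => hall v : Finset.univ ⊆ ({a, b} : Finset V))
      rw [Finset.card_univ, hV] at this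
      exact absurd (this.trans Finset.card_le_two) (by norm_num)
    simp only [Finset.mem_insert, Finset.mem_singleton, not_or] at hc
    obtain ⟨d, e, -, hsum⟩ := exists_univ_eq_of_card_eq_five hV he (Ne.symm hc.1) (Ne.symm hc.2)
    rw [hsum, hsum, Finset.sum_singleton, edgeForm_mk, h]
    push_cast
    linarith [edge_form_le (x a) (x b) (x c) (x d) (x e)]
  · obtain ⟨e, f, hef, rfl⟩ := Finset.card_eq_two.1 h
    rw [Finset.sum_pair hef, h]
    push_cast
    obtain ⟨a, b, c, hab, hac, hbc, rfl, rfl⟩ | ⟨a, b, c, d, hab, hcd, hac, had, hbc, hbd, rfl, rfl⟩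
      := Sym2.share_or_disjoint (hE e (by simp)) (hE f (by simp)) hef
    · obtain ⟨d, e, -, hsum⟩ := exists_univ_eq_of_card_eq_five hV hab hac hbc
      rw [hsum, hsum, edgeForm_mk, edgeForm_mk]
      linarith [path_two_form_le (x a) (x b) (x c) (x d) (x e)]
    · obtain ⟨p, q, hmem, hsum⟩ := exists_univ_eq_of_card_eq_five hV hab hac hbc
      rw [hsum, hsum, edgeForm_mk, edgeForm_mk]
      have hd := hmem d
      obtain rfl | rfl : d = p ∨ d = q := by grind
      · linarith [two_edges_form_le (x a) (x b) (x c) (x d) (x q)]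
      · linarith [two_edges_form_le (x a) (x b) (x c) (x d) (x p)]
  · obtain ⟨e, f, g, hef, heg, hfg, rfl⟩ := Finset.card_eq_three.1 h
    have he := hE e (by simp)
    have hf := hE f (by simp)
    have hg := hE g (by simp)
    rw [Finset.sum_insert (by simp [hef, heg]), Finset.sum_pair hfg, h]
    push_cast
    obtain ⟨a, b, c, hab, hac, hbc, rfl, rfl⟩ | ⟨a, b, c, d, hab, hcd, hac, had, hbc, hbd, rfl, rfl⟩
      := Sym2.share_or_disjoint he hf hef
    · linarith [edgeForm_three_le_of_share hV x hab hac hbc hg heg hfg]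
    obtain ⟨a', b', c', hab', hac', hbc', h1, rfl⟩ |
      ⟨a', b', p, q, -, hpq, h1, h2, h3, h4, h5, rfl⟩ := Sym2.share_or_disjoint he hg heg
    · rw [h1] at hef ⊢
      linarith [edgeForm_three_le_of_share hV x hab' hac' hbc' hf hef hfg.symm]
    obtain ⟨a'', b'', c'', hab'', hac'', hbc'', h6, h7⟩ |
      ⟨c', d', p', q', -, -, h6, h7, h8, h9, h10, h11⟩ := Sym2.share_or_disjoint hf hg hfg
    · rw [h6] at hef ⊢
      rw [h7] at heg ⊢
      linarith [edgeForm_three_le_of_share hV x hab'' hac'' hbc'' he hef.symm heg.symm]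
    -- Three pairwise disjoint edges would need six vertices.
    · obtain ⟨u, v, hmem, -⟩ := exists_univ_eq_of_card_eq_five hV hab hac hbc
      rw [Sym2.eq_iff] at h5 h10 h11
      have hd := hmem d
      have hp := hmem p
      have hq := hmem q
      grind

end FiveVertices

/-! ### Passage to the complement and the base case -/

theorem sum_sum_mem_sym2 {V : Type*} [Fintype V] [DecidableEq V] (T : Sym2 V → ℝ)
    (E : Finset (Sym2 V)) (hE : ∀ e ∈ E, ¬ e.IsDiag) :
    ∑ i, ∑ j, (if s(i, j) ∈ E then T s(i, j) else 0) = 2 * ∑ e ∈ E, T e := by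
  induction E using Finset.induction_on with
  | empty => simp
  | insert e E he ih =>
    rw [Finset.sum_insert he, mul_add, ← ih fun f hf => hE f (Finset.mem_insert_of_mem hf)]
    have hd := hE e (Finset.mem_insert_self _ _)
    have h1 : ∀ i j, (if s(i, j) ∈ insert e E then T s(i, j) else 0) =
        (if s(i, j) = e then T e else 0) + if s(i, j) ∈ E then T s(i, j) else 0 := by
      intro i j
      by_cases h : s(i, j) = e
      · simp [h, he]
      · simp [h]
    simp only [h1, Finset.sum_add_distrib]
    congr 1
    induction e with | _ a b
    rw [Sym2.mk_isDiag_iff] at hd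
    have h2 : ∀ i j, (if s(i, j) = s(a, b) then T s(a, b) else 0) =
        (if i = a then if j = b then T s(a, b) else 0 else 0) +
          if i = b then if j = a then T s(a, b) else 0 else 0 := by
      intro i j
      simp only [Sym2.eq_iff]
      by_cases hi : i = a
      · subst hi
        simp [hd]
      · simp [hi, ite_and]
    simp only [h2, Finset.sum_add_distrib, Finset.sum_ite_irrel, Finset.sum_ite_eq',
      Finset.sum_const_zero, Finset.mem_univ, if_true]
    ring

namespace SimpleGraph

variable {V : Type*} [DecidableEq V]

/-- Lower bound for the signless Laplacian form of a graph on five vertices, obtained from the upper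
bound for the complement. -/
theorem signless_form_le_of_card_eq_five [Fintype V] (hV : Fintype.card V = 5)
    (G : SimpleGraph V) [DecidableRel G.Adj] (x : V → ℝ) :
    (∑ i, x i ^ 2) * (∑ i, ∑ j, if G.Adj i j then 1 else 0) / 3 - 4 * (∑ i, x i ^ 2) -
        (∑ i, ∑ j, if G.Adj i j then x i ^ 2 else 0) / 6 ≤
      (∑ i, ∑ j, if G.Adj i j then (x i + x j) ^ 2 else 0) / 2 := by
  have hdiag : ∀ e ∈ Gᶜ.edgeFinset, ¬ e.IsDiag := fun e he =>
    Gᶜ.not_isDiag_of_mem_edgeSet (mem_edgeFinset.1 he)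
  have hcompl : ∀ T : Sym2 V → ℝ, (∑ i, ∑ j, if G.Adj i j then T s(i, j) else 0) =
      (∑ i, ∑ j, T s(i, j)) - (∑ i, T s(i, i)) - 2 * ∑ e ∈ Gᶜ.edgeFinset, T e := by
    intro T
    rw [← sum_sum_mem_sym2 T _ hdiag, ← Finset.sum_sub_distrib, ← Finset.sum_sub_distrib]
    refine Finset.sum_congr rfl fun i _ => ?_
    have h1 : T s(i, i) = ∑ j, if j = i then T s(i, j) else 0 := by simp
    rw [h1, ← Finset.sum_sub_distrib, ← Finset.sum_sub_distrib]
    refine Finset.sum_congr rfl fun j _ => ?_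
    simp only [mem_edgeFinset, mem_edgeSet, compl_adj]
    by_cases hij : j = i
    · subst hij
      simp
    · by_cases h : G.Adj i j <;> simp [h, hij, Ne.symm hij]
  have hM := hcompl fun _ => 1
  simp only [Finset.sum_const, Finset.card_univ, hV, nsmul_eq_mul, mul_one] at hM
  push_cast at hM
  have hX : 0 ≤ ∑ i, x i ^ 2 := Finset.sum_nonneg fun _ _ => sq_nonneg _
  rw [hM]
  by_cases hcard : Gᶜ.edgeFinset.card ≤ 3
  · have hE := sum_edgeForm_le hV x _ hdiag hcard
    have hF := hcompl (edgeForm x)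
    have hsplit : (∑ i, ∑ j, if G.Adj i j then edgeForm x s(i, j) else 0) =
        (∑ i, ∑ j, if G.Adj i j then (x i + x j) ^ 2 else 0) +
          (∑ i, ∑ j, if G.Adj i j then x i ^ 2 else 0) / 3 := by
      have hswap : (∑ i, ∑ j, if G.Adj i j then x j ^ 2 else 0) =
          ∑ i, ∑ j, if G.Adj i j then x i ^ 2 else 0 := by
        rw [Finset.sum_comm]
        simp only [G.adj_comm]
      have h2 : ∀ i j, (if G.Adj i j then edgeForm x s(i, j) else 0) =
          (if G.Adj i j then (x i + x j) ^ 2 else 0) +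
            ((if G.Adj i j then x i ^ 2 else 0) + if G.Adj i j then x j ^ 2 else 0) / 6 := by
        intro i j
        split_ifs <;> simp
      simp only [h2, Finset.sum_add_distrib, ← Finset.sum_div, hswap]
      ring
    have hall : ∑ i, ∑ j, edgeForm x s(i, j) =
        35 / 3 * (∑ i, x i ^ 2) + 2 * (∑ i, x i) ^ 2 := by
      have h3 : ∀ i j, edgeForm x s(i, j) = 7 / 6 * x i ^ 2 + 7 / 6 * x j ^ 2 + 2 * (x i * x j) := by
        intro i j
        rw [edgeForm_mk]
        ring
      simp only [h3, Finset.sum_add_distrib, ← Finset.mul_sum, Finset.sum_const, Finset.card_univ,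
        hV, nsmul_eq_mul, ← Finset.sum_mul]
      push_cast
      ring
    have hloop : ∑ i, edgeForm x s(i, i) = 13 / 3 * ∑ i, x i ^ 2 := by
      rw [Finset.mul_sum]
      refine Finset.sum_congr rfl fun i _ => ?_
      rw [edgeForm_mk]
      ring
    rw [hsplit, hall, hloop] at hF
    linarith
  -- With four missing edges M ≤ 12, so M/3 - 4 ≤ 0 and the left side is nonpositive.
  · have h4 : (4 : ℝ) ≤ Gᶜ.edgeFinset.card := by exact_mod_cast not_le.1 hcard
    have hD : 0 ≤ ∑ i, ∑ j, if G.Adj i j then x i ^ 2 else 0 :=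
      Finset.sum_nonneg fun _ _ => Finset.sum_nonneg fun _ _ => by split_ifs <;> positivity
    have hF : 0 ≤ ∑ i, ∑ j, if G.Adj i j then (x i + x j) ^ 2 else 0 :=
      Finset.sum_nonneg fun _ _ => Finset.sum_nonneg fun _ _ => by split_ifs <;> positivity
    nlinarith [mul_nonneg hX (sub_nonneg.2 h4)]

end SimpleGraph

/-! ### Averaging over vertex deletions -/

section Deletion

variable {V : Type*} [DecidableEq V]

theorem sum_sum_erase (t : V → V → ℝ) (ht : ∀ v, t v v = 0) {U : Finset V} {v : V} (hv : v ∈ U) :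
    ∑ i ∈ U.erase v, ∑ j ∈ U.erase v, t i j =
      (∑ i ∈ U, ∑ j ∈ U, t i j) - (∑ j ∈ U, t v j) - ∑ i ∈ U, t i v := by
  simp only [Finset.sum_erase_eq_sub hv, Finset.sum_sub_distrib, ht]
  ring

/-- A pair of distinct vertices survives all deletions but those of its two members. -/
theorem sum_sum_sum_erase (t : V → V → ℝ) (ht : ∀ v, t v v = 0) (U : Finset V) :
    ∑ v ∈ U, ∑ i ∈ U.erase v, ∑ j ∈ U.erase v, t i j =
      ((U.card : ℝ) - 2) * ∑ i ∈ U, ∑ j ∈ U, t i j := by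
  rw [Finset.sum_congr rfl fun v hv => sum_sum_erase t ht hv, Finset.sum_sub_distrib,
    Finset.sum_sub_distrib, Finset.sum_comm (f := fun v i => t i v), Finset.sum_const, nsmul_eq_mul]
  ring

end Deletion

namespace SimpleGraph

variable {V : Type*} [DecidableEq V]

/-- Lower bound for the signless Laplacian form of the subgraph induced by `U`, with a term in the
degrees that makes the bound inductive under averaging over vertex deletions. -/
theorem signless_form_le (G : SimpleGraph V) [DecidableRel G.Adj] (x : V → ℝ) {k : ℕ}
    (hk : 5 ≤ k) : ∀ U : Finset V, U.card = k →
    (∑ i ∈ U, x i ^ 2) * (∑ i ∈ U, ∑ j ∈ U, if G.Adj i j then 1 else 0) / ((k : ℝ) - 2) -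
          ((k : ℝ) - 1) * (∑ i ∈ U, x i ^ 2) +
        (1 / 2 - 2 / ((k : ℝ) - 2)) * (∑ i ∈ U, ∑ j ∈ U, if G.Adj i j then x i ^ 2 else 0) ≤
      (∑ i ∈ U, ∑ j ∈ U, if G.Adj i j then (x i + x j) ^ 2 else 0) / 2 := by
  induction k, hk using Nat.le_induction with
  | base =>
    intro U hU
    have h := signless_form_le_of_card_eq_five (V := U) (by rw [Fintype.card_coe, hU])
      (G.comap Subtype.val) (fun i => x i)
    simp only [comap_adj] at h
    have e1 := Finset.sum_coe_sort U fun i => x i ^ 2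
    have e2 : ∀ t : V → V → ℝ, ∑ i : U, ∑ j : U, t i j = ∑ i ∈ U, ∑ j ∈ U, t i j := fun t => by
      simp only [Finset.sum_coe_sort U (t _)]
      exact Finset.sum_coe_sort U fun i => ∑ j ∈ U, t i j
    rw [e1, e2 fun i j => if G.Adj i j then 1 else 0, e2 fun i j => if G.Adj i j then x i ^ 2 else 0,
      e2 fun i j => if G.Adj i j then (x i + x j) ^ 2 else 0] at h
    push_cast
    linarith
  | succ k hk ih =>
    intro U hU
    have hk' : (5 : ℝ) ≤ k := by exact_mod_cast hk
    have hstep := Finset.sum_le_sum fun v (hv : v ∈ U) =>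
      ih (U.erase v) (by rw [Finset.card_erase_of_mem hv, hU, Nat.add_sub_cancel])
    have hUc : (U.card : ℝ) = k + 1 := by rw [hU]; push_cast; ring
    rw [Finset.sum_add_distrib, Finset.sum_sub_distrib, ← Finset.sum_div, ← Finset.sum_div,
      ← Finset.mul_sum, ← Finset.mul_sum, sum_sum_sum_erase _ (by simp),
      sum_sum_sum_erase _ (by simp), hUc] at hstep
    have hX : ∑ v ∈ U, ∑ i ∈ U.erase v, x i ^ 2 = k * ∑ i ∈ U, x i ^ 2 := by
      rw [Finset.sum_congr rfl fun v hv => Finset.sum_erase_eq_sub hv, Finset.sum_sub_distrib,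
        Finset.sum_const, nsmul_eq_mul, hUc]
      ring
    -- Summing (X - x_v²)(M - 2 deg v) over v gives (k+1-2-1) X M, plus 2D from the products x_v²
    -- deg v.
    have hXM : ∑ v ∈ U, (∑ i ∈ U.erase v, x i ^ 2) *
          (∑ i ∈ U.erase v, ∑ j ∈ U.erase v, if G.Adj i j then (1 : ℝ) else 0) =
        ((k : ℝ) - 2) * ((∑ i ∈ U, x i ^ 2) *
          ∑ i ∈ U, ∑ j ∈ U, if G.Adj i j then (1 : ℝ) else 0) +
          2 * ∑ i ∈ U, ∑ j ∈ U, if G.Adj i j then x i ^ 2 else 0 := by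
      have hrow : ∀ v, (∑ i ∈ U, if G.Adj i v then (1 : ℝ) else 0) =
          ∑ j ∈ U, if G.Adj v j then 1 else 0 := fun v => by simp only [G.adj_comm]
      have hterm : ∀ v ∈ U, (∑ i ∈ U.erase v, x i ^ 2) *
            (∑ i ∈ U.erase v, ∑ j ∈ U.erase v, if G.Adj i j then (1 : ℝ) else 0) =
          (∑ i ∈ U, x i ^ 2) * (∑ i ∈ U, ∑ j ∈ U, if G.Adj i j then (1 : ℝ) else 0) -
            2 * ((∑ i ∈ U, x i ^ 2) * ∑ j ∈ U, if G.Adj v j then (1 : ℝ) else 0) -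
            x v ^ 2 * (∑ i ∈ U, ∑ j ∈ U, if G.Adj i j then (1 : ℝ) else 0) +
            2 * ∑ j ∈ U, if G.Adj v j then x v ^ 2 else 0 := by
        intro v hv
        have hd : (∑ j ∈ U, if G.Adj v j then x v ^ 2 else 0) =
            x v ^ 2 * ∑ j ∈ U, if G.Adj v j then 1 else 0 := by
          rw [Finset.mul_sum]
          simp only [mul_ite, mul_one, mul_zero]
        rw [sum_sum_erase _ (by simp) hv, Finset.sum_erase_eq_sub hv, hrow, hd]
        ring
      rw [Finset.sum_congr rfl hterm, Finset.sum_add_distrib, Finset.sum_sub_distrib,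
        Finset.sum_sub_distrib, Finset.sum_const, nsmul_eq_mul, hUc, ← Finset.mul_sum,
        ← Finset.mul_sum, ← Finset.mul_sum, ← Finset.sum_mul]
      ring
    rw [hX, hXM] at hstep
    push_cast
    set X := ∑ i ∈ U, x i ^ 2
    set M := ∑ i ∈ U, ∑ j ∈ U, if G.Adj i j then (1 : ℝ) else 0
    set D := ∑ i ∈ U, ∑ j ∈ U, if G.Adj i j then x i ^ 2 else 0
    set F := ∑ i ∈ U, ∑ j ∈ U, if G.Adj i j then (x i + x j) ^ 2 else 0
    have h2 : (k : ℝ) - 2 ≠ 0 := by linarith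
    have h1 : (0 : ℝ) < (k : ℝ) - 1 := by linarith
    -- The D coefficients match because 2/((k-1)(k-2)) - 2/(k-2) = -2/(k-1).
    refine le_of_mul_le_mul_left (le_trans (le_of_eq ?_) (hstep.trans (le_of_eq ?_))) h1
    · rw [show (k : ℝ) + 1 - 2 = k - 1 by ring]
      field_simp
      ring
    · ring

end SimpleGraph

/-! ### From forms to eigenvalues -/

namespace SimpleGraph

variable {V : Type*} [Fintype V] [DecidableEq V] (G : SimpleGraph V) [DecidableRel G.Adj]

theorem dotProduct_mulVec_signlessLapMatrix (x : V → ℝ) :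
    x ⬝ᵥ (G.signlessLapMatrix).mulVec x =
      (∑ i, ∑ j, if G.Adj i j then (x i + x j) ^ 2 else 0) / 2 := by
  have hswap : (∑ i, ∑ j, if G.Adj i j then x j ^ 2 else 0) =
      ∑ i, ∑ j, if G.Adj i j then x i ^ 2 else 0 := by
    rw [Finset.sum_comm]
    simp only [G.adj_comm]
  have hterm : ∀ i j, (if G.Adj i j then (x i + x j) ^ 2 else 0) =
      (if G.Adj i j then x i ^ 2 else 0) + (if G.Adj i j then x j ^ 2 else 0) +
        2 * if G.Adj i j then x i * x j else 0 := by
    intro i j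
    split_ifs <;> ring
  have hdeg : x ⬝ᵥ (G.degMatrix ℝ).mulVec x = ∑ i, ∑ j, if G.Adj i j then x i ^ 2 else 0 := by
    rw [dotProduct_mulVec_degMatrix]
    refine Finset.sum_congr rfl fun i _ => ?_
    rw [degree_eq_sum_if_adj, Finset.sum_mul, Finset.sum_mul]
    refine Finset.sum_congr rfl fun j _ => ?_
    split_ifs <;> ring
  have hadj : x ⬝ᵥ (G.adjMatrix ℝ).mulVec x = ∑ i, ∑ j, if G.Adj i j then x i * x j else 0 := by
    refine Finset.sum_congr rfl fun i _ => ?_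
    rw [Matrix.mulVec, dotProduct, Finset.mul_sum]
    refine Finset.sum_congr rfl fun j _ => ?_
    rw [adjMatrix_apply]
    split_ifs <;> ring
  simp only [hterm, Finset.sum_add_distrib, ← Finset.mul_sum, hswap]
  rw [signlessLapMatrix, Matrix.add_mulVec, dotProduct_add, hdeg, hadj]
  ring

/-- Evaluate the form at a unit eigenvector; the ordering of the eigenvalues plays no role. -/
theorem le_signlessLapEigenvalue {q : ℝ}
    (hq : ∀ x : V → ℝ, q * ∑ i, x i ^ 2 ≤ x ⬝ᵥ (G.signlessLapMatrix).mulVec x)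
    (k : Fin (Fintype.card V)) : q ≤ G.signlessLapEigenvalue k := by
  have hA := G.isHermitian_signlessLapMatrix
  set i : V := Fintype.equivOfCardEq (Fintype.card_fin _) k with hi
  have hk : G.signlessLapEigenvalue k = hA.eigenvalues i := by
    rw [signlessLapEigenvalue, Matrix.IsHermitian.eigenvalues, hi, Equiv.symm_apply_apply]
  have hnorm : ∑ j, hA.eigenvectorBasis i j ^ 2 = 1 := by
    rw [← EuclideanSpace.real_norm_sq_eq, hA.eigenvectorBasis.orthonormal.1 i, one_pow]
  have h := hq (hA.eigenvectorBasis i)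
  rw [hA.mulVec_eigenvectorBasis, dotProduct_smul, hnorm, smul_eq_mul, mul_one] at h
  have hself : (hA.eigenvectorBasis i : V → ℝ) ⬝ᵥ (hA.eigenvectorBasis i : V → ℝ) = 1 := by
    rw [← hnorm]
    exact Finset.sum_congr rfl fun j _ => (sq _).symm
  rwa [hself, mul_one, ← hk] at h

theorem signlessLapEigenvalue_nonneg (k : Fin (Fintype.card V)) :
    0 ≤ G.signlessLapEigenvalue k := by
  refine G.le_signlessLapEigenvalue (fun x => ?_) k
  rw [dotProduct_mulVec_signlessLapMatrix, zero_mul]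
  exact div_nonneg (Finset.sum_nonneg fun _ _ => Finset.sum_nonneg fun _ _ => by
    split_ifs <;> positivity) zero_le_two

theorem sub_le_signlessLapEigenvalue (hV : 6 ≤ Fintype.card V) (k : Fin (Fintype.card V)) :
    2 * (G.edgeFinset.card : ℝ) / ((Fintype.card V : ℝ) - 2) - (Fintype.card V : ℝ) + 1 ≤
      G.signlessLapEigenvalue k := by
  refine G.le_signlessLapEigenvalue (fun x => ?_) k
  have h := G.signless_form_le x (by omega) Finset.univ Finset.card_univ
  have hM : (∑ i, ∑ j, if G.Adj i j then (1 : ℝ) else 0) = 2 * G.edgeFinset.card := by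
    simp only [← degree_eq_sum_if_adj]
    exact_mod_cast G.sum_degrees_eq_twice_card_edges
  have hn : (6 : ℝ) ≤ Fintype.card V := by exact_mod_cast hV
  -- This is where n ≥ 6 is needed: the coefficient vanishes at n = 6 and is negative at n = 5.
  have hc : 0 ≤ 1 / 2 - 2 / ((Fintype.card V : ℝ) - 2) := by
    rw [sub_nonneg, div_le_div_iff₀ (by linarith) zero_lt_two]
    linarith
  have hD : 0 ≤ ∑ i, ∑ j, if G.Adj i j then x i ^ 2 else 0 :=
    Finset.sum_nonneg fun _ _ => Finset.sum_nonneg fun _ _ => by split_ifs <;> positivity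
  rw [dotProduct_mulVec_signlessLapMatrix]
  rw [hM] at h
  refine le_trans (le_of_eq ?_) (le_trans (le_add_of_nonneg_right (mul_nonneg hc hD)) h)
  ring

end SimpleGraph

/-- Both bounds are affine in m and vanish at 2m = (n-1)(n-2); the one with denominator n-2 is
steeper. -/
theorem div_pred_sub_le_max {n m : ℝ} (hn : 2 < n) :
    2 * m / (n - 1) - n + 2 ≤ max 0 (2 * m / (n - 2) - n + 1) := by
  have h1 : 0 < n - 1 := by linarith
  have h2 : 0 < n - 2 := by linarith
  rcases le_total (2 * m) ((n - 2) * (n - 1)) with h | h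
  · refine le_max_of_le_left ?_
    linarith [(div_le_iff₀ h1).2 h]
  · refine le_max_of_le_right ?_
    have h3 : 2 * m / (n - 2) - 2 * m / (n - 1) = 2 * m / ((n - 2) * (n - 1)) := by
      field_simp
      ring
    linarith [(one_le_div₀ (mul_pos h2 h1)).2 h]

theorem theorem1p2 {V : Type*} [Fintype V] [DecidableEq V] (G : SimpleGraph V)
    [DecidableRel G.Adj] (n m : ℕ) (hn : 6 ≤ n) (hV : Fintype.card V = n)
    (hm : G.edgeFinset.card = m) :
    2 * (m : ℝ) / ((n : ℝ) - 2) - (n : ℝ) + 1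
        ≤ G.signlessLapEigenvalue ⟨n - 1, by omega⟩ ∧
      2 * (m : ℝ) / ((n : ℝ) - 1) - (n : ℝ) + 2
        ≤ max 0 (2 * (m : ℝ) / ((n : ℝ) - 2) - (n : ℝ) + 1) ∧
      2 * (m : ℝ) / ((n : ℝ) - 1) - (n : ℝ) + 2
        ≤ G.signlessLapEigenvalue ⟨n - 1, by omega⟩ := by
  subst hV hm
  have hn' : (2 : ℝ) < Fintype.card V := by exact_mod_cast (by omega : 2 < Fintype.card V)
  refine ⟨G.sub_le_signlessLapEigenvalue hn _, div_pred_sub_le_max hn', ?_⟩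
  exact (div_pred_sub_le_max hn').trans
    (max_le (G.signlessLapEigenvalue_nonneg _) (G.sub_le_signlessLapEigenvalue hn _))
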